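/- Let $X$ be a connected (Hausdorff, second countable, finite-dimensional) complex manifold. The Kobayashi pseudodistance $\mathsf{k}_X(x,y)$ is the infimum of $\sum_{j=1}^n \rho(a_j,b_j)$ over all finite chains of holomorphic maps $f_1,\dots,f_n:\mathbb{D}\to X$ and points $a_j,b_j$ of the unit disc $\mathbb{D}$ with $f_1(a_1)=x$, $f_j(b_j)=f_{j+1}(a_{j+1})$ for $1\le j<n$, and $f_n(b_n)=y$, where $\rho(z,w)=\tanh^{-1}\left|\frac{z-w}{1-\overline{w}z}\right|$ is the Poincaré distance. Suppose that $X$ is Kobayashi hyperbolic, i.e. $\mathsf{k}_X(x,y)=0$ only if $x=y$; no completeness of $\mathsf{k}_X$ is assumed. Let $C(X)$ be the space of real-valued continuous functions on the metric space $(X,\mathsf{k}_X)$ with the topology of locally uniform convergence, let $C_*(X)$ be its quotient by the subspace of constant functions, with the quotient topology, and let $i_{\mathsf{k}}:X\to C_*(X)$, $i_{\mathsf{k}}(x)=[\mathsf{k}_X(x,\cdot)]$. Let $\overline{X}^{\mathsf{k}}$, the metric (horofunction) compactification, be the closure of $i_{\mathsf{k}}(X)$ in $C_*(X)$, with the subspace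 topology. Then the topology of $(X,\mathsf{k}_X)$ is the manifold topology of $X$, and $(\overline{X}^{\mathsf{k}}, i_{\mathsf{k}})$ is a compactification of $X$: the space $\overline{X}^{\mathsf{k}}$ is sequentially compact and Hausdorff, $i_{\mathsf{k}}:X\to\overline{X}^{\mathsf{k}}$ is a homeomorphism onto its image, and $i_{\mathsf{k}}(X)$ is open and dense in $\overline{X}^{\mathsf{k}}$. -/

import Mathlib

open Set Topology
open scoped Manifold ContDiff ENNReal ComplexConjugate

/-! ### Compactifications -/

/-- A map `ι : X → Y` exhibits `Y` as a compactification of `X`: the space `Y` is sequentially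
compact and Hausdorff, and `ι` is a homeomorphism onto its image, which is open and dense. -/
structure IsCompactification {X Y : Type*} [TopologicalSpace X] [TopologicalSpace Y]
    (ι : X → Y) : Prop where
  seqCompact : SeqCompactSpace Y
  hausdorff : T2Space Y
  isEmbedding : IsEmbedding ι
  isOpen_range : IsOpen (range ι)
  dense_range : Dense (range ι)

/-! ### The metric compactification of a metric space -/

/-- The subspace of constant functions in `C(X)`. -/
def constFunctions (X : Type*) [TopologicalSpace X] : Submodule ℝ C(X, ℝ) where
  carrier := {f | ∃ c : ℝ, f = ContinuousMap.const X c}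
  add_mem' := by
    rintro _ _ ⟨c, rfl⟩ ⟨d, rfl⟩
    exact ⟨c + d, rfl⟩
  zero_mem' := ⟨0, rfl⟩
  smul_mem' := by
    rintro r _ ⟨c, rfl⟩
    exact ⟨r * c, rfl⟩

/-- `C_*(X)`: continuous functions modulo constants, with the quotient topology. Mathlib's
topology on `C(X, ℝ)` is the compact-open topology, which on a locally compact space is the
topology of locally uniform convergence. -/
abbrev FunctionsModConst (X : Type*) [TopologicalSpace X] : Type _ :=
  C(X, ℝ) ⧸ constFunctions X

/-- The function `d_x = d(x, ·)`. -/
def distFrom {X : Type*} [MetricSpace X] (x : X) : C(X, ℝ) where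
  toFun z := dist x z
  continuous_toFun := continuous_const.dist continuous_id

/-- The map `i_d : X → C_*(X)`, `x ↦ [d(x, ·)]`. -/
def distClass {X : Type*} [MetricSpace X] (x : X) : FunctionsModConst X :=
  (constFunctions X).mkQ (distFrom x)

/-- The metric (horofunction) compactification: the closure of `i_d(X)` in `C_*(X)`, with the
subspace topology. -/
abbrev MetricCompactification (X : Type*) [MetricSpace X] : Type _ :=
  closure (range (distClass : X → FunctionsModConst X))

/-- The canonical map of a metric space into its metric compactification. -/
def toMetricCompactification {X : Type*} [MetricSpace X] (x : X) : MetricCompactification X :=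
  ⟨distClass x, subset_closure (mem_range_self x)⟩

/-! ### The Kobayashi distance -/

/-- The Poincaré distance of the open unit disc,
`ρ(z, w) = artanh |(z - w) / (1 - conj w * z)|`. -/
noncomputable def poincareDist (z w : ℂ) : ℝ :=
  Real.artanh ‖(z - w) / (1 - conj w * z)‖

/-- `f` restricts to a holomorphic map from the open unit disc to `X`, where `X` is a complex
manifold modelled on `E`. Values of `f` off the disc are irrelevant. -/
def IsHolomorphicDisc (E : Type*) [NormedAddCommGroup E] [NormedSpace ℂ E] {X : Type*}
    [TopologicalSpace X] [ChartedSpace E X] (f : ℂ → X) : Prop :=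
  MDifferentiableOn 𝓘(ℂ, ℂ) 𝓘(ℂ, E) f (Metric.ball 0 1)

/-- `DiscChain E x y L`: there is a finite chain of holomorphic discs from `x` to `y` of total
Poincaré length `L`, that is, there are holomorphic discs `f₁, …, fₙ` and points `aⱼ, bⱼ` of the
unit disc with `f₁ a₁ = x`, `fⱼ bⱼ = fⱼ₊₁ aⱼ₊₁`, `fₙ bₙ = y` and `L = ∑ ρ(aⱼ, bⱼ)`. -/
inductive DiscChain (E : Type*) [NormedAddCommGroup E] [NormedSpace ℂ E] {X : Type*}
    [TopologicalSpace X] [ChartedSpace E X] : X → X → ℝ → Prop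
  | nil (x : X) : DiscChain E x x 0
  | cons {f : ℂ → X} {a b : ℂ} {y : X} {L : ℝ} (hf : IsHolomorphicDisc E f)
      (ha : a ∈ Metric.ball (0 : ℂ) 1) (hb : b ∈ Metric.ball (0 : ℂ) 1)
      (h : DiscChain E (f b) y L) : DiscChain E (f a) y (poincareDist a b + L)

/-- The Kobayashi pseudodistance: the infimum of the lengths of chains of holomorphic discs
joining the two points (`∞` if there are none). -/
noncomputable def kobayashiEDist (E : Type*) [NormedAddCommGroup E] [NormedSpace ℂ E] {X : Type*}
    [TopologicalSpace X] [ChartedSpace E X] (x y : X) : ℝ≥0∞ :=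
  ⨅ (L : ℝ) (_ : DiscChain E x y L), ENNReal.ofReal L

/-- Kobayashi hyperbolicity: the Kobayashi pseudodistance separates points. -/
class KobayashiHyperbolic (E : Type*) [NormedAddCommGroup E] [NormedSpace ℂ E] (X : Type*)
    [TopologicalSpace X] [ChartedSpace E X] : Prop where
  eq_of_kobayashiEDist_eq_zero : ∀ x y : X, kobayashiEDist E x y = 0 → x = y

section KobayashiFacts

variable {E : Type*} [NormedAddCommGroup E] [NormedSpace ℂ E] {X : Type*}
  [TopologicalSpace X] [ChartedSpace E X]

theorem poincareDist_comm (z w : ℂ) : poincareDist z w = poincareDist w z := by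
  have h : ‖1 - conj w * z‖ = ‖1 - conj z * w‖ := by
    rw [← Complex.norm_conj (1 - conj w * z)]
    simp [mul_comm]
  simp only [poincareDist, norm_div, h, norm_sub_rev z w]

theorem DiscChain.append {x y z : X} {L L' : ℝ} (h : DiscChain E x y L)
    (h' : DiscChain E y z L') : DiscChain E x z (L + L') := by
  induction h with
  | nil => simpa using h'
  | cons hf ha hb _ ih =>
    rw [add_assoc]
    exact DiscChain.cons hf ha hb (ih h')

theorem DiscChain.reverse {x y : X} {L : ℝ} (h : DiscChain E x y L) : DiscChain E y x L := by
  induction h with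
  | nil x => exact DiscChain.nil x
  | @cons f a b y L hf ha hb _ ih =>
    have h1 : DiscChain E (f b) (f a) (poincareDist a b) := by
      simpa [poincareDist_comm b a] using DiscChain.cons hf hb ha (DiscChain.nil (f a))
    rw [add_comm]
    exact ih.append h1

theorem kobayashiEDist_self (x : X) : kobayashiEDist E x x = 0 := by
  refine le_antisymm (iInf₂_le_of_le 0 (DiscChain.nil x) ?_) zero_le
  simp

theorem kobayashiEDist_comm (x y : X) : kobayashiEDist E x y = kobayashiEDist E y x :=
  le_antisymm (le_iInf₂ fun L h => iInf₂_le L h.reverse)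
    (le_iInf₂ fun L h => iInf₂_le L h.reverse)

theorem kobayashiEDist_triangle (x y z : X) :
    kobayashiEDist E x z ≤ kobayashiEDist E x y + kobayashiEDist E y z := by
  unfold kobayashiEDist
  simp only [ENNReal.iInf_add, ENNReal.add_iInf]
  refine le_iInf₂ fun L h => le_iInf₂ fun L' h' => ?_
  exact (iInf₂_le _ (DiscChain.append (by assumption) (by assumption))).trans
    ENNReal.ofReal_add_le

theorem exists_discChain_eventually [IsManifold 𝓘(ℂ, E) ω X] (x : X) :
    ∀ᶠ y in 𝓝 x, ∃ L, DiscChain E x y L := by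
  set φ := chartAt E x with hφ
  obtain ⟨r, hr, hball⟩ := Metric.isOpen_iff.1 φ.open_target (φ x)
    (φ.map_source (mem_chart_source E x))
  have hnear : ∀ᶠ y in 𝓝 x, φ y ∈ Metric.ball (φ x) (r / 2) :=
    (φ.continuousAt (mem_chart_source E x)).eventually (Metric.ball_mem_nhds _ (by positivity))
  filter_upwards [hnear, chart_source_mem_nhds E x] with y hy hys
  set v : E := φ y - φ x with hv
  have hvr : ‖v‖ < r / 2 := by simpa [hv, dist_eq_norm] using hy
  set g : ℂ → E := fun ζ => φ x + (2 * ζ) • v with hg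
  have hmaps : MapsTo g (Metric.ball 0 1) φ.target := by
    intro ζ hζ
    apply hball
    have hζ' : ‖ζ‖ < 1 := by simpa using hζ
    have : 2 * ‖ζ‖ * ‖v‖ < r := by nlinarith [norm_nonneg ζ, norm_nonneg v]
    simpa [hg, dist_eq_norm, norm_smul] using this
  have hgd : MDifferentiableOn 𝓘(ℂ, ℂ) 𝓘(ℂ, E) g (Metric.ball 0 1) := by
    have : Differentiable ℂ g := by simp only [hg]; fun_prop
    exact this.mdifferentiable.mdifferentiableOn
  have hsymm : MDifferentiableOn 𝓘(ℂ, E) 𝓘(ℂ, E) φ.symm φ.target :=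
    (contMDiffOn_chart_symm (I := 𝓘(ℂ, E)) (n := ω) (x := x)).mdifferentiableOn (by simp)
  have hdisc : IsHolomorphicDisc E (φ.symm ∘ g) := hsymm.comp hgd hmaps
  have h0 : (φ.symm ∘ g) 0 = x := by
    simp [hg, φ.left_inv (mem_chart_source E x)]
  have h1 : (φ.symm ∘ g) (1 / 2) = y := by
    simp [hg, hv, φ.left_inv hys]
  have hchain := DiscChain.cons (a := 0) (b := 1 / 2) hdisc (by simp) (by simp; norm_num)
    (DiscChain.nil _)
  rw [h0, h1] at hchain
  exact ⟨_, hchain⟩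

theorem exists_discChain [IsManifold 𝓘(ℂ, E) ω X] [ConnectedSpace X] (x y : X) :
    ∃ L, DiscChain E x y L :=
  PreconnectedSpace.induction₂' (fun x y : X => ∃ L, DiscChain E x y L)
    (fun z => (exists_discChain_eventually z).mono fun _ ⟨L, h⟩ => ⟨⟨L, h⟩, ⟨L, h.reverse⟩⟩)
    ⟨fun _ _ _ ⟨_, h⟩ ⟨_, h'⟩ => ⟨_, h.append h'⟩⟩ x y

theorem kobayashiEDist_ne_top [IsManifold 𝓘(ℂ, E) ω X] [ConnectedSpace X] (x y : X) :
    kobayashiEDist E x y ≠ ⊤ := by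
  obtain ⟨L, h⟩ := exists_discChain (E := E) x y
  exact ne_top_of_le_ne_top ENNReal.ofReal_ne_top (iInf₂_le L h)

end KobayashiFacts

/-- The set `X`, regarded as a metric space through the Kobayashi distance only (the manifold
topology is not used for its topology). -/
def KobayashiSpace (E : Type*) (X : Type*) [NormedAddCommGroup E] [NormedSpace ℂ E]
    [TopologicalSpace X] [ChartedSpace E X] : Type _ := X

/-- The identity map from the manifold `X` to the metric space `(X, k_X)`. -/
def toKobayashiSpace (E : Type*) {X : Type*} [NormedAddCommGroup E] [NormedSpace ℂ E]
    [TopologicalSpace X] [ChartedSpace E X] (x : X) : KobayashiSpace E X := x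

/-- The Kobayashi distance of a connected Kobayashi hyperbolic complex manifold; its topology is
the one defined by the distance. -/
noncomputable instance KobayashiSpace.instMetricSpace {E : Type*} {X : Type*} [NormedAddCommGroup E] [NormedSpace ℂ E]
    [TopologicalSpace X] [ChartedSpace E X] [IsManifold 𝓘(ℂ, E) ω X] [ConnectedSpace X]
    [KobayashiHyperbolic E X] : MetricSpace (KobayashiSpace E X) where
  dist x y := (kobayashiEDist E (X := X) x y).toReal
  dist_self x := by simp [kobayashiEDist_self (E := E) (X := X) x]
  dist_comm x y := by rw [kobayashiEDist_comm (E := E) (X := X) x y]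
  dist_triangle x y z := by
    rw [← ENNReal.toReal_add (kobayashiEDist_ne_top (E := E) (X := X) x y)
      (kobayashiEDist_ne_top (E := E) (X := X) y z)]
    exact ENNReal.toReal_mono (ENNReal.add_ne_top.2
      ⟨kobayashiEDist_ne_top (E := E) (X := X) x y, kobayashiEDist_ne_top (E := E) (X := X) y z⟩)
      (kobayashiEDist_triangle (E := E) (X := X) x y z)
  eq_of_dist_eq_zero := by
    intro x y h
    refine KobayashiHyperbolic.eq_of_kobayashiEDist_eq_zero (E := E) (X := X) x y ?_
    exact ((ENNReal.toReal_eq_zero_iff _).1 h).resolve_right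
      (kobayashiEDist_ne_top (E := E) (X := X) x y)

/-!
Cutting a chain of discs along Poincaré geodesics yields a connected set joining `x` to `y`, and
every point `p` of it satisfies `k(x, p) + k(p, y) ≤ L`, where `L` is the length of the chain. Such
a set with `L` close to `k(x, y)` replaces a minimizing geodesic, which need not exist when `k` is
not complete.

This is used twice. A connected set leaving a compact neighbourhood of `x` meets its frontier, on
which `k(x, ·)` is bounded below, so small Kobayashi balls stay inside the neighbourhood and `k`
defines the manifold topology. And if `y` lies outside a compact ball about `x`, then `k(y, ·)` is
smaller at some point of the bounding sphere than at `x`, whereas `k(x, ·)` is larger on the whole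
sphere than at `x`. The latter strict inequality is an open condition on a class modulo constants,
so the points whose class is close to that of `x` stay in a compact ball, which makes the embedding
into the compactification open. Compactness is Arzelà–Ascoli for `1`-Lipschitz functions vanishing
at a base point.
-/

section FunctionsModConst

variable {X : Type*} [TopologicalSpace X]

theorem mem_constFunctions_iff {f : C(X, ℝ)} : f ∈ constFunctions X ↔ ∀ x y, f x = f y := by
  refine ⟨by rintro ⟨c, rfl⟩ _ _; rfl, fun h => ?_⟩
  rcases isEmpty_or_nonempty X with _ | ⟨⟨x⟩⟩
  · exact ⟨0, ContinuousMap.ext fun y => isEmptyElim y⟩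
  · exact ⟨f x, ContinuousMap.ext fun y => h y x⟩

theorem mkQ_constFunctions_eq_iff {f g : C(X, ℝ)} :
    (constFunctions X).mkQ f = (constFunctions X).mkQ g ↔ ∀ x y, f x - g x = f y - g y :=
  (Submodule.Quotient.eq _).trans mem_constFunctions_iff

instance isClosed_constFunctions : IsClosed (constFunctions X : Set C(X, ℝ)) := by
  have h : (constFunctions X : Set C(X, ℝ)) = ⋂ (x : X) (y : X), {f | f x = f y} := by
    ext f
    simp only [SetLike.mem_coe, mem_constFunctions_iff, mem_iInter, mem_ofPred_eq]
  rw [h]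
  exact isClosed_iInter fun x => isClosed_iInter fun y =>
    isClosed_eq (continuous_eval_const x) (continuous_eval_const y)

theorem isOpen_setOf_forall_mem_lt {K : Set X} (hK : IsCompact K) (x : X) :
    IsOpen {f : C(X, ℝ) | ∀ z ∈ K, f x < f z} := by
  have hsub : Continuous fun f : C(X, ℝ) => f - ContinuousMap.const X (f x) :=
    continuous_id.sub (ContinuousMap.continuous_const'.comp (continuous_eval_const x))
  convert! (ContinuousMap.isOpen_setOfPred_mapsTo hK (isOpen_Ioi (a := (0 : ℝ)))).preimage hsub
    using 1
  ext f
  simp [MapsTo]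

end FunctionsModConst

theorem isCompact_setOf_lipschitzWith_apply_eq {X Y : Type*} [PseudoMetricSpace X] [MetricSpace Y]
    [ProperSpace Y] (C : NNReal) (x : X) (y : Y) :
    IsCompact {f : C(X, Y) | f x = y ∧ LipschitzWith C f} := by
  refine ArzelaAscoli.isCompact_of_equicontinuous _ ?_
    (LipschitzWith.uniformEquicontinuous _ C fun f => f.2.2).equicontinuous
  have himage : ContinuousMap.toFun '' {f : C(X, Y) | f x = y ∧ LipschitzWith C f} =
      {f : X → Y | f x = y ∧ LipschitzWith C f} := by
    ext f
    exact ⟨by rintro ⟨g, hg, rfl⟩; exact hg, fun hf => ⟨⟨f, hf.2.continuous⟩, hf, rfl⟩⟩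
  rw [himage]
  refine (isCompact_univ_pi fun z => isCompact_closedBall y (C * dist z x)).of_isClosed_subset
    ?_ ?_
  · simp only [lipschitzWith_iff_dist_le_mul, ofPred_and, ofPred_forall]
    exact (isClosed_eq (continuous_apply x) continuous_const).inter <|
      isClosed_iInter fun z => isClosed_iInter fun w =>
        isClosed_le ((continuous_apply z).dist (continuous_apply w)) continuous_const
  · rintro f ⟨rfl, hf⟩ z -
    exact hf.dist_le_mul z x

section MetricCompactification

variable {M : Type*} [MetricSpace M]

theorem continuous_distClass : Continuous (distClass : M → FunctionsModConst M) :=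
  (constFunctions M).isOpenQuotientMap_mkQ.continuous.comp
    (ContinuousMap.continuous_of_continuous_uncurry _ continuous_dist)

theorem injective_distClass : Function.Injective (distClass : M → FunctionsModConst M) := by
  intro x y h
  have hxy : dist x x - dist y x = dist x y - dist y y := mkQ_constFunctions_eq_iff.1 h x y
  rw [dist_self, dist_self, dist_comm y x] at hxy
  exact dist_eq_zero.1 (by linarith)

theorem isCompact_closure_range_distClass :
    IsCompact (closure (range (distClass : M → FunctionsModConst M))) := by
  rcases isEmpty_or_nonempty M with _ | ⟨⟨x⟩⟩
  · simp only [range_eq_empty, closure_empty, isCompact_empty]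
  refine ((isCompact_setOf_lipschitzWith_apply_eq 1 x (0 : ℝ)).image
    (constFunctions M).isOpenQuotientMap_mkQ.continuous).closure_of_subset ?_
  rintro _ ⟨y, rfl⟩
  refine ⟨distFrom y - ContinuousMap.const M (dist y x), ⟨sub_self _, ?_⟩,
    mkQ_constFunctions_eq_iff.2 fun z w => ?_⟩
  · refine LipschitzWith.of_dist_le_mul fun z w => ?_
    change |dist y z - dist y x - (dist y w - dist y x)| ≤ 1 * dist z w
    simpa only [one_mul, sub_sub_sub_cancel_right, dist_comm y] using abs_dist_sub_le z w y
  · simp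

theorem seqCompactSpace_metricCompactification [LocallyCompactSpace M] [SigmaCompactSpace M] :
    SeqCompactSpace (MetricCompactification M) := by
  have : CompactSpace (MetricCompactification M) :=
    isCompact_iff_compactSpace.1 isCompact_closure_range_distClass
  have : FirstCountableTopology (FunctionsModConst M) :=
    QuotientAddGroup.instFirstCountableTopology (constFunctions M).toAddSubgroup
  infer_instance

theorem denseRange_toMetricCompactification :
    DenseRange (toMetricCompactification : M → MetricCompactification M) := by
  intro ξ
  rw [closure_subtype, ← range_comp]
  exact ξ.2

/-- Approximate geodesicity: from `x` one can move by any distance `r ≤ dist x y` towards `y` while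
losing arbitrarily little length. It is a substitute for geodesics that does not need
completeness. -/
def HasApproxIntermediatePoints (M : Type*) [PseudoMetricSpace M] : Prop :=
  ∀ x y : M, ∀ r ∈ Icc 0 (dist x y), ∀ ε > 0, ∃ z, dist x z = r ∧ r + dist z y < dist x y + ε

namespace HasApproxIntermediatePoints

theorem exists_isOpen_distClass (hM : HasApproxIntermediatePoints M) (x : M) {r : ℝ} (hr : 0 < r)
    (hc : IsCompact (Metric.closedBall x r)) :
    ∃ U : Set (FunctionsModConst M), IsOpen U ∧ distClass x ∈ U ∧
      ∀ y, distClass y ∈ U → y ∈ Metric.ball x r := by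
  have hsphere : IsCompact (Metric.sphere x r) :=
    hc.of_isClosed_subset Metric.isClosed_sphere Metric.sphere_subset_closedBall
  refine ⟨(constFunctions M).mkQ '' {f | ∀ z ∈ Metric.sphere x r, f x < f z},
    (constFunctions M).isOpenQuotientMap_mkQ.isOpenMap _ (isOpen_setOf_forall_mem_lt hsphere x),
    mem_image_of_mem _ fun z hz => ?_, ?_⟩
  · change dist x x < dist x z
    rwa [dist_self, Metric.mem_sphere'.1 hz]
  · rintro y ⟨f, hf, hfy⟩
    by_contra hy
    -- A point of the sphere almost between `x` and `y` is no farther from `y` than `x` is.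
    obtain ⟨z, hz, hzy⟩ := hM x y r ⟨hr.le, by simpa [dist_comm] using hy⟩ r hr
    have hfz : f x - dist y x = f z - dist y z := mkQ_constFunctions_eq_iff.1 hfy x z
    linarith [hf z (Metric.mem_sphere'.2 hz), dist_comm x y, dist_comm z y]

theorem isOpenMap_toMetricCompactification [LocallyCompactSpace M]
    (hM : HasApproxIntermediatePoints M) :
    IsOpenMap (toMetricCompactification : M → MetricCompactification M) := by
  refine IsOpenMap.of_nhds_le fun x V hV => ?_
  obtain ⟨r, hr, hrV, hc⟩ : ∃ r > 0, Metric.closedBall x r ⊆ toMetricCompactification ⁻¹' V ∧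
      IsCompact (Metric.closedBall x r) :=
    ((eventually_closedBall_subset hV).and (Metric.eventually_isCompact_closedBall x)).exists_gt
  obtain ⟨U, hU, hxU, hball⟩ := hM.exists_isOpen_distClass x hr hc
  have hclosure : U ∩ closure (range distClass) ⊆ distClass '' Metric.closedBall x r :=
    hU.inter_closure.trans <| closure_minimal
      (by rintro _ ⟨hyU, y, rfl⟩; exact ⟨y, Metric.ball_subset_closedBall (hball y hyU), rfl⟩)
      (hc.image continuous_distClass).isClosed
  filter_upwards [(hU.preimage continuous_subtype_val).mem_nhds hxU] with ξ hξ
  obtain ⟨y, hy, hyξ⟩ := hclosure ⟨hξ, ξ.2⟩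
  rw [← show toMetricCompactification y = ξ from Subtype.ext hyξ]
  exact hrV hy

theorem isCompactification [LocallyCompactSpace M] [SigmaCompactSpace M]
    (hM : HasApproxIntermediatePoints M) :
    IsCompactification (toMetricCompactification : M → MetricCompactification M) where
  seqCompact := seqCompactSpace_metricCompactification
  hausdorff := inferInstance
  isEmbedding := (IsOpenEmbedding.of_continuous_injective_isOpenMap
    (continuous_distClass.subtype_mk _) (injective_distClass.codRestrict _)
    hM.isOpenMap_toMetricCompactification).isEmbedding
  isOpen_range := hM.isOpenMap_toMetricCompactification.isOpen_range
  dense_range := denseRange_toMetricCompactification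

end HasApproxIntermediatePoints

end MetricCompactification

section NearGeodesics

theorem nonempty_inter_frontier_of_isPreconnected {X : Type*} [TopologicalSpace X] {S V : Set X}
    (hS : IsPreconnected S) (hSV : (S ∩ V).Nonempty) (hSV' : (S ∩ Vᶜ).Nonempty) :
    (S ∩ frontier V).Nonempty := by
  by_contra! hdisj
  have hcover : S ⊆ interior V ∪ (closure V)ᶜ := fun p hp => by
    by_contra! hpV
    simp only [mem_union, mem_compl_iff, not_or, not_not] at hpV
    exact hdisj.subset ⟨hp, hpV.2, hpV.1⟩
  obtain ⟨x, hxS, hxV⟩ := hSV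
  obtain ⟨y, hyS, hyV⟩ := hSV'
  obtain ⟨p, -, hpV, hpV'⟩ := hS _ _ isOpen_interior isClosed_closure.isOpen_compl hcover
    ⟨x, hxS, (hcover hxS).resolve_right (not_not.2 (subset_closure hxV))⟩
    ⟨y, hyS, (hcover hyS).resolve_left fun h => hyV (interior_subset h)⟩
  exact hpV' (interior_subset_closure hpV)

/-- Any two points of `X` are joined by a connected subset of `X` whose image in `M` lies
metrically between their images, up to an arbitrarily small error. The connectedness refers to the
topology of `X`, which is not assumed to be induced by `M`; connected sets replace curves. -/
def HasNearGeodesics {X M : Type*} [TopologicalSpace X] [PseudoMetricSpace M] (ι : X → M) :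
    Prop :=
  ∀ (x y : X) (c : ℝ), dist (ι x) (ι y) < c →
    ∃ S, IsPreconnected S ∧ x ∈ S ∧ y ∈ S ∧ ∀ p ∈ S, dist (ι x) (ι p) + dist (ι p) (ι y) < c

namespace HasNearGeodesics

variable {X M : Type*} [TopologicalSpace X]

theorem isEmbedding [LocallyCompactSpace X] [MetricSpace M] {ι : X → M} (h : HasNearGeodesics ι)
    (hcont : Continuous ι) (hinj : Function.Injective ι) : IsEmbedding ι := by
  refine ⟨isInducing_iff_nhds.2 fun x => (hcont.tendsto x).le_comap.antisymm fun U hU => ?_, hinj⟩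
  have : T2Space X := .of_injective_continuous hinj hcont
  obtain ⟨K, hK, hKU, hKc⟩ := local_compact_nhds hU
  have hclosed : IsClosed (ι '' frontier K) :=
    ((hKc.of_isClosed_subset isClosed_frontier hKc.isClosed.frontier_subset).image hcont).isClosed
  have hx : ι x ∉ ι '' frontier K := by
    rintro ⟨p, hp, hpx⟩
    exact hp.2 (hinj hpx ▸ mem_interior_iff_mem_nhds.2 hK)
  obtain ⟨δ, hδ, hball⟩ := Metric.mem_nhds_iff.1 (hclosed.isOpen_compl.mem_nhds hx)
  refine ⟨Metric.ball (ι x) δ, Metric.ball_mem_nhds _ hδ, fun y hy => hKU ?_⟩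
  by_contra hyK
  obtain ⟨S, hS, hxS, hyS, hbetween⟩ := h x y δ (Metric.mem_ball'.1 hy)
  obtain ⟨p, hpS, hpK⟩ := nonempty_inter_frontier_of_isPreconnected hS
    ⟨x, hxS, mem_of_mem_nhds hK⟩ ⟨y, hyS, hyK⟩
  have hxp : dist (ι x) (ι p) < δ :=
    (le_add_of_nonneg_right dist_nonneg).trans_lt (hbetween p hpS)
  exact hball (Metric.mem_ball'.2 hxp) (mem_image_of_mem ι hpK)

theorem hasApproxIntermediatePoints [PseudoMetricSpace M] {ι : X → M} (h : HasNearGeodesics ι)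
    (hcont : Continuous ι) (hsurj : Function.Surjective ι) : HasApproxIntermediatePoints M := by
  refine hsurj.forall₂.2 fun x y r hr ε hε => ?_
  obtain ⟨S, hS, hxS, hyS, hbetween⟩ := h x y _ (lt_add_of_pos_right _ hε)
  obtain ⟨p, hpS, rfl⟩ := hS.intermediate_value hxS hyS
    (continuous_const.dist hcont).continuousOn (by rwa [dist_self])
  exact ⟨ι p, rfl, hbetween p hpS⟩

end HasNearGeodesics

end NearGeodesics

section PoincareDisc

theorem artanh_sub_artanh {x y : ℝ} (hx : x ∈ Ioo (-1) 1) (hy : y ∈ Ioo (-1) 1) :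
    Real.artanh x - Real.artanh y = Real.artanh ((x - y) / (1 - x * y)) := by
  obtain ⟨hx₀, hx₁⟩ := hx
  obtain ⟨hy₀, hy₁⟩ := hy
  have hxy : 0 < 1 - x * y := by nlinarith
  have hplus : 1 + (x - y) / (1 - x * y) = (1 + x) * (1 - y) / (1 - x * y) := by
    field_simp
    ring
  have hminus : 1 - (x - y) / (1 - x * y) = (1 - x) * (1 + y) / (1 - x * y) := by
    field_simp
    ring
  have hquot : (x - y) / (1 - x * y) ∈ Icc (-1) 1 := by
    rw [mem_Icc, le_div_iff₀ hxy, div_le_iff₀ hxy]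
    constructor <;> nlinarith
  rw [Real.artanh_eq_half_log ⟨hx₀.le, hx₁.le⟩, Real.artanh_eq_half_log ⟨hy₀.le, hy₁.le⟩,
    Real.artanh_eq_half_log hquot, ← mul_sub, ← Real.log_div, hplus, hminus]
  · congr 2
    have : 1 - x ≠ 0 := by linarith
    have : 1 + y ≠ 0 := by linarith
    have : 1 - y ≠ 0 := by linarith
    field_simp
  · exact (div_pos (by linarith) (by linarith)).ne'
  · exact (div_pos (by linarith) (by linarith)).ne'

theorem poincareDist_nonneg (z w : ℂ) : 0 ≤ poincareDist z w :=
  Real.artanh_nonneg (norm_nonneg _)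

theorem poincareDist_zero_left (w : ℂ) : poincareDist 0 w = Real.artanh ‖w‖ := by
  simp [poincareDist]

theorem poincareDist_add_of_mem_segment {z w : ℂ} (hw : ‖w‖ < 1) (hz : z ∈ segment ℝ 0 w) :
    poincareDist 0 z + poincareDist z w = poincareDist 0 w := by
  obtain ⟨t, ⟨ht₀, ht₁⟩, rfl⟩ : ∃ t ∈ Icc (0 : ℝ) 1, (t : ℂ) * w = z := by
    simpa [segment_eq_image'] using hz
  have htw : ‖(t : ℂ) * w‖ = t * ‖w‖ := by
    rw [norm_mul, Complex.norm_real, Real.norm_of_nonneg ht₀]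
  have hle : t * ‖w‖ ≤ ‖w‖ := mul_le_of_le_one_left (norm_nonneg w) ht₁
  have hpos : 0 ≤ t * ‖w‖ := by positivity
  have hsub : ‖t * w - w‖ = ‖w‖ - t * ‖w‖ := by
    rw [← sub_one_mul, norm_mul, ← Complex.ofReal_one, ← Complex.ofReal_sub, Complex.norm_real,
      Real.norm_of_nonpos (by linarith)]
    ring
  have hconj : ‖1 - conj w * (t * w)‖ = 1 - ‖w‖ * (t * ‖w‖) := by
    have : 1 - conj w * (t * w) = ((1 - ‖w‖ * (t * ‖w‖) : ℝ) : ℂ) := by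
      push_cast
      linear_combination -(t : ℂ) * Complex.conj_mul' w
    rw [this, Complex.norm_real, Real.norm_of_nonneg (by nlinarith)]
  rw [poincareDist_zero_left, poincareDist_zero_left, poincareDist, norm_div, hsub, hconj, htw,
    ← artanh_sub_artanh ⟨by linarith [norm_nonneg w], hw⟩ ⟨by linarith, by linarith⟩]
  ring

/-- The automorphism `z ↦ (z + a) / (1 + conj a * z)` of the unit disc, which carries `0` to `a`. -/
noncomputable def discMobius (a z : ℂ) : ℂ := (z + a) / (1 + conj a * z)

section DiscMobius

variable {a z w : ℂ}

theorem discMobius_zero (a : ℂ) : discMobius a 0 = a := by simp [discMobius]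

theorem one_add_conj_mul_ne_zero (ha : ‖a‖ < 1) (hz : ‖z‖ < 1) : 1 + conj a * z ≠ 0 := by
  intro h
  have hnorm : ‖a‖ * ‖z‖ = 1 := by
    simpa using congrArg norm (eq_neg_of_add_eq_zero_right h)
  nlinarith [norm_nonneg a, norm_nonneg z]

theorem one_sub_conj_discMobius_mul_discMobius (ha : ‖a‖ < 1) (hz : ‖z‖ < 1) (hw : ‖w‖ < 1) :
    1 - conj (discMobius a w) * discMobius a z =
      (1 - conj a * a) * (1 - conj w * z) / (conj (1 + conj a * w) * (1 + conj a * z)) := by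
  have hz' := one_add_conj_mul_ne_zero ha hz
  have hw' := (map_ne_zero (starRingEnd ℂ)).2 (one_add_conj_mul_ne_zero ha hw)
  rw [discMobius, discMobius, map_div₀, div_mul_div_comm, one_sub_div (mul_ne_zero hw' hz')]
  congr 1
  simp only [map_add, map_mul, map_one, Complex.conj_conj]
  ring

theorem discMobius_sub_discMobius (ha : ‖a‖ < 1) (hz : ‖z‖ < 1) (hw : ‖w‖ < 1) :
    discMobius a z - discMobius a w =
      (1 - conj a * a) * (z - w) / ((1 + conj a * w) * (1 + conj a * z)) := by
  rw [discMobius, discMobius, div_sub_div _ _ (one_add_conj_mul_ne_zero ha hz)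
    (one_add_conj_mul_ne_zero ha hw), mul_comm (1 + conj a * w)]
  congr 1
  ring

theorem poincareDist_discMobius (ha : ‖a‖ < 1) (hz : ‖z‖ < 1) (hw : ‖w‖ < 1) :
    poincareDist (discMobius a z) (discMobius a w) = poincareDist z w := by
  have hz' := norm_ne_zero_iff.2 (one_add_conj_mul_ne_zero ha hz)
  have hw' := norm_ne_zero_iff.2 (one_add_conj_mul_ne_zero ha hw)
  have ha' : ‖1 - conj a * a‖ ≠ 0 := by
    rw [norm_ne_zero_iff]
    simpa [sub_eq_add_neg] using one_add_conj_mul_ne_zero ha ((norm_neg a).trans_lt ha)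
  rw [poincareDist, poincareDist, discMobius_sub_discMobius ha hz hw,
    one_sub_conj_discMobius_mul_discMobius ha hz hw]
  simp only [norm_div, norm_mul, Complex.norm_conj]
  congr 1
  rw [div_div_div_cancel_right₀ (mul_ne_zero hw' hz'), mul_div_mul_left _ _ ha']

theorem norm_discMobius_lt_one (ha : ‖a‖ < 1) (hz : ‖z‖ < 1) : ‖discMobius a z‖ < 1 := by
  have hden : 0 < ‖1 + conj a * z‖ ^ 2 :=
    pow_pos (norm_pos_iff.2 (one_add_conj_mul_ne_zero ha hz)) 2
  have hident : 1 - ‖discMobius a z‖ ^ 2 =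
      (1 - ‖a‖ ^ 2) * (1 - ‖z‖ ^ 2) / ‖1 + conj a * z‖ ^ 2 := by
    have h := one_sub_conj_discMobius_mul_discMobius ha hz hz
    simp only [Complex.conj_mul'] at h
    exact_mod_cast h
  have hpos : 0 < 1 - ‖discMobius a z‖ ^ 2 := by
    rw [hident]
    refine div_pos (mul_pos ?_ ?_) hden <;> nlinarith [norm_nonneg a, norm_nonneg z]
  exact (sq_lt_one_iff₀ (norm_nonneg _)).1 (sub_pos.1 hpos)

theorem discMobius_discMobius_neg (ha : ‖a‖ < 1) (hz : ‖z‖ < 1) :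
    discMobius a (discMobius (-a) z) = z := by
  have ha' : ‖-a‖ < 1 := (norm_neg a).trans_lt ha
  have hcancel : discMobius (-a) z * (1 + conj (-a) * z) = z + -a :=
    div_mul_cancel₀ _ (one_add_conj_mul_ne_zero ha' hz)
  rw [discMobius, div_eq_iff (one_add_conj_mul_ne_zero ha (norm_discMobius_lt_one ha' hz))]
  rw [map_neg] at hcancel
  linear_combination hcancel

theorem continuousOn_discMobius (ha : ‖a‖ < 1) :
    ContinuousOn (discMobius a) (Metric.ball 0 1) :=
  ContinuousOn.div (by fun_prop) (by fun_prop) fun _ hz =>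
    one_add_conj_mul_ne_zero ha (mem_ball_zero_iff.1 hz)

end DiscMobius

theorem exists_isPreconnected_poincareDist_add_eq {a b : ℂ} (ha : a ∈ Metric.ball (0 : ℂ) 1)
    (hb : b ∈ Metric.ball (0 : ℂ) 1) :
    ∃ S ⊆ Metric.ball (0 : ℂ) 1, IsPreconnected S ∧ a ∈ S ∧ b ∈ S ∧
      ∀ p ∈ S, poincareDist a p + poincareDist p b = poincareDist a b := by
  rw [mem_ball_zero_iff] at ha hb
  set w := discMobius (-a) b
  have hw : ‖w‖ < 1 := norm_discMobius_lt_one ((norm_neg a).trans_lt ha) hb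
  have hwb : discMobius a w = b := discMobius_discMobius_neg ha hb
  have hball : segment ℝ 0 w ⊆ Metric.ball 0 1 :=
    (convex_ball 0 1).segment_subset (by simp) (mem_ball_zero_iff.2 hw)
  refine ⟨discMobius a '' segment ℝ 0 w, ?_,
    (convex_segment 0 w).isPreconnected.image _ ((continuousOn_discMobius ha).mono hball),
    ⟨0, left_mem_segment ℝ 0 w, discMobius_zero a⟩, ⟨w, right_mem_segment ℝ 0 w, hwb⟩, ?_⟩
  · rintro _ ⟨z, hz, rfl⟩
    exact mem_ball_zero_iff.2 (norm_discMobius_lt_one ha (mem_ball_zero_iff.1 (hball hz)))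
  · rintro _ ⟨z, hz, rfl⟩
    have hz' : ‖z‖ < 1 := mem_ball_zero_iff.1 (hball hz)
    have h := poincareDist_add_of_mem_segment hw hz
    rwa [← poincareDist_discMobius ha (by simp) hz', ← poincareDist_discMobius ha hz' hw,
      ← poincareDist_discMobius ha (by simp) hw, discMobius_zero, hwb] at h

end PoincareDisc

section Kobayashi

variable {E : Type*} [NormedAddCommGroup E] [NormedSpace ℂ E] {X : Type*}
  [TopologicalSpace X] [ChartedSpace E X]

theorem DiscChain.nonneg {x y : X} {L : ℝ} (h : DiscChain E x y L) : 0 ≤ L := by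
  induction h with
  | nil => exact le_rfl
  | cons _ _ _ _ ih => exact add_nonneg (poincareDist_nonneg _ _) ih

theorem DiscChain.kobayashiEDist_le {x y : X} {L : ℝ} (h : DiscChain E x y L) :
    kobayashiEDist E x y ≤ ENNReal.ofReal L :=
  iInf₂_le L h

theorem IsHolomorphicDisc.kobayashiEDist_le {f : ℂ → X} (hf : IsHolomorphicDisc E f) {a b : ℂ}
    (ha : a ∈ Metric.ball (0 : ℂ) 1) (hb : b ∈ Metric.ball (0 : ℂ) 1) :
    kobayashiEDist E (f a) (f b) ≤ ENNReal.ofReal (poincareDist a b) := by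
  simpa only [add_zero] using (DiscChain.cons hf ha hb (.nil (f b))).kobayashiEDist_le

theorem IsHolomorphicDisc.exists_isPreconnected {f : ℂ → X} (hf : IsHolomorphicDisc E f)
    {a b : ℂ} (ha : a ∈ Metric.ball (0 : ℂ) 1) (hb : b ∈ Metric.ball (0 : ℂ) 1) :
    ∃ S, IsPreconnected S ∧ f a ∈ S ∧ f b ∈ S ∧ ∀ p ∈ S,
      kobayashiEDist E (f a) p + kobayashiEDist E p (f b) ≤
        ENNReal.ofReal (poincareDist a b) := by
  obtain ⟨S, hSball, hS, haS, hbS, hadd⟩ := exists_isPreconnected_poincareDist_add_eq ha hb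
  refine ⟨f '' S, hS.image f (hf.continuousOn.mono hSball), mem_image_of_mem f haS,
    mem_image_of_mem f hbS, ?_⟩
  rintro _ ⟨q, hq, rfl⟩
  rw [← hadd q hq, ENNReal.ofReal_add (poincareDist_nonneg _ _) (poincareDist_nonneg _ _)]
  exact add_le_add (hf.kobayashiEDist_le ha (hSball hq)) (hf.kobayashiEDist_le (hSball hq) hb)

theorem DiscChain.exists_isPreconnected {x y : X} {L : ℝ} (h : DiscChain E x y L) :
    ∃ S, IsPreconnected S ∧ x ∈ S ∧ y ∈ S ∧ ∀ p ∈ S,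
      kobayashiEDist E x p + kobayashiEDist E p y ≤ ENNReal.ofReal L := by
  induction h with
  | nil x =>
    refine ⟨{x}, isPreconnected_singleton, rfl, rfl, ?_⟩
    rintro _ rfl
    simp [kobayashiEDist_self]
  | @cons f a b y L hf ha hb h ih =>
    obtain ⟨S, hS, haS, hbS, hSadd⟩ := hf.exists_isPreconnected ha hb
    obtain ⟨T, hT, hbT, hyT, hTadd⟩ := ih
    refine ⟨S ∪ T, hS.union (f b) hbS hbT hT, Or.inl haS, Or.inr hyT, ?_⟩
    rw [ENNReal.ofReal_add (poincareDist_nonneg _ _) h.nonneg]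
    rintro p (hp | hp)
    · calc
        kobayashiEDist E (f a) p + kobayashiEDist E p y
          ≤ kobayashiEDist E (f a) p +
              (kobayashiEDist E p (f b) + kobayashiEDist E (f b) y) := by
            gcongr
            exact kobayashiEDist_triangle p (f b) y
        _ = kobayashiEDist E (f a) p + kobayashiEDist E p (f b) +
              kobayashiEDist E (f b) y := (add_assoc _ _ _).symm
        _ ≤ _ := add_le_add (hSadd p hp) h.kobayashiEDist_le
    · calc
        kobayashiEDist E (f a) p + kobayashiEDist E p y
          ≤ kobayashiEDist E (f a) (f b) + kobayashiEDist E (f b) p +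
              kobayashiEDist E p y := by
            gcongr
            exact kobayashiEDist_triangle (f a) (f b) p
        _ = kobayashiEDist E (f a) (f b) +
              (kobayashiEDist E (f b) p + kobayashiEDist E p y) := add_assoc _ _ _
        _ ≤ _ := add_le_add (hf.kobayashiEDist_le ha hb) (hTadd p hp)

variable [IsManifold 𝓘(ℂ, E) ω X]

theorem isHolomorphicDisc_chartAt_symm {x : X} {r : ℝ} {v : E}
    (hball : Metric.ball (chartAt E x x) r ⊆ (chartAt E x).target) (hv : ‖v‖ < r) :
    IsHolomorphicDisc E fun ζ : ℂ => (chartAt E x).symm (chartAt E x x + ζ • v) := by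
  have hline : Differentiable ℂ fun ζ : ℂ => chartAt E x x + ζ • v := by fun_prop
  refine (contMDiffOn_chart_symm (I := 𝓘(ℂ, E)) (n := ω) (x := x)).mdifferentiableOn (by simp)
    |>.comp hline.mdifferentiable.mdifferentiableOn fun ζ hζ => hball ?_
  rw [mem_ball_iff_norm, add_sub_cancel_left, norm_smul]
  exact (mul_le_of_le_one_left (norm_nonneg v) (mem_ball_zero_iff.1 hζ).le).trans_lt hv

theorem eventually_kobayashiEDist_le_artanh (x : X) {s : ℝ} (hs : s ∈ Ioo 0 1) :
    ∀ᶠ y in 𝓝 x, kobayashiEDist E x y ≤ ENNReal.ofReal (Real.artanh s) := by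
  obtain ⟨hs₀, hs₁⟩ := hs
  set φ := chartAt E x
  obtain ⟨r, hr, hball⟩ := Metric.isOpen_iff.1 φ.open_target (φ x)
    (φ.map_source (mem_chart_source E x))
  have hnear : ∀ᶠ y in 𝓝 x, φ y ∈ Metric.ball (φ x) (s * r) :=
    (φ.continuousAt (mem_chart_source E x)).eventually (Metric.ball_mem_nhds _ (mul_pos hs₀ hr))
  filter_upwards [hnear, chart_source_mem_nhds E x] with y hy hys
  have hv : ‖(s : ℂ)⁻¹ • (φ y - φ x)‖ < r := by
    rwa [norm_smul, norm_inv, Complex.norm_real, Real.norm_of_nonneg hs₀.le,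
      inv_mul_lt_iff₀ hs₀, ← mem_ball_iff_norm]
  have hs : ‖(s : ℂ)‖ = s := by rw [Complex.norm_real, Real.norm_of_nonneg hs₀.le]
  have hle := (isHolomorphicDisc_chartAt_symm hball hv).kobayashiEDist_le (a := 0) (b := s)
    (by simp) (by rwa [mem_ball_zero_iff, hs])
  have hs_ne : (s : ℂ) ≠ 0 := by exact_mod_cast hs₀.ne'
  rwa [zero_smul, add_zero, smul_inv_smul₀ hs_ne, add_sub_cancel, φ.left_inv hys,
    φ.left_inv (mem_chart_source E x), poincareDist_zero_left, hs] at hle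

theorem tendsto_kobayashiEDist_nhds_zero (x : X) :
    Filter.Tendsto (kobayashiEDist E x) (𝓝 x) (𝓝 0) := by
  refine ENNReal.tendsto_nhds_zero.2 fun ε hε => ?_
  obtain ⟨t, ht, htε⟩ := ENNReal.lt_iff_exists_nnreal_btwn.1 hε
  have htanh : Real.tanh t ∈ Ioo 0 1 := by
    refine ⟨?_, Real.tanh_lt_one _⟩
    rw [Real.tanh_eq_sinh_div_cosh]
    exact div_pos (Real.sinh_pos_iff.2 (by exact_mod_cast ht)) (Real.cosh_pos _)
  filter_upwards [eventually_kobayashiEDist_le_artanh (E := E) x htanh] with y hy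
  rw [Real.artanh_tanh, ENNReal.ofReal_coe_nnreal] at hy
  exact hy.trans htε.le

variable [ConnectedSpace X] [KobayashiHyperbolic E X]

theorem edist_toKobayashiSpace (x y : X) :
    edist (toKobayashiSpace E x) (toKobayashiSpace E y) = kobayashiEDist E x y :=
  (edist_dist _ _).trans (ENNReal.ofReal_toReal (kobayashiEDist_ne_top x y))

theorem continuous_toKobayashiSpace :
    Continuous (toKobayashiSpace E : X → KobayashiSpace E X) := by
  refine continuous_iff_continuousAt.2 fun x => tendsto_iff_edist_tendsto_0.2 ?_
  simpa only [edist_comm _ (toKobayashiSpace E x), edist_toKobayashiSpace] using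
    tendsto_kobayashiEDist_nhds_zero (E := E) x

theorem hasNearGeodesics_toKobayashiSpace :
    HasNearGeodesics (toKobayashiSpace E : X → KobayashiSpace E X) := by
  intro x y c hxy
  obtain ⟨L, hL, hLc⟩ : ∃ L, DiscChain E x y L ∧ ENNReal.ofReal L < ENNReal.ofReal c := by
    simpa only [edist_toKobayashiSpace, kobayashiEDist, iInf_lt_iff, exists_prop] using
      edist_lt_ofReal.2 hxy
  obtain ⟨S, hS, hxS, hyS, hbetween⟩ := hL.exists_isPreconnected
  refine ⟨S, hS, hxS, hyS, fun p hp => ?_⟩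
  rw [dist_edist, dist_edist, ← ENNReal.toReal_add (edist_ne_top _ _) (edist_ne_top _ _),
    edist_toKobayashiSpace, edist_toKobayashiSpace]
  exact ENNReal.toReal_lt_of_lt_ofReal ((hbetween p hp).trans_lt hLc)

end Kobayashi

theorem theorem1p1 {E : Type*} [NormedAddCommGroup E] [NormedSpace ℂ E] [FiniteDimensional ℂ E]
    {X : Type*} [TopologicalSpace X] [ChartedSpace E X] [IsManifold 𝓘(ℂ, E) ω X]
    [T2Space X] [SecondCountableTopology X] [ConnectedSpace X] [KobayashiHyperbolic E X] :
    IsHomeomorph (toKobayashiSpace E : X → KobayashiSpace E X) ∧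
      IsCompactification
        (toMetricCompactification : KobayashiSpace E X →
          MetricCompactification (KobayashiSpace E X)) := by
  have : LocallyCompactSpace X := Manifold.locallyCompact_of_finiteDimensional 𝓘(ℂ, E)
  have hnear := hasNearGeodesics_toKobayashiSpace (E := E) (X := X)
  have hcont := continuous_toKobayashiSpace (E := E) (X := X)
  have hhomeo : IsHomeomorph (toKobayashiSpace E : X → KobayashiSpace E X) :=
    isHomeomorph_iff_isEmbedding_surjective.2
      ⟨hnear.isEmbedding hcont Function.injective_id, Function.surjective_id⟩
  have hclosed := hhomeo.homeomorph.symm.isClosedEmbedding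
  have : LocallyCompactSpace (KobayashiSpace E X) := hclosed.locallyCompactSpace
  have : SigmaCompactSpace (KobayashiSpace E X) := hclosed.sigmaCompactSpace
  exact ⟨hhomeo,
    (hnear.hasApproxIntermediatePoints hcont Function.surjective_id).isCompactification⟩
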